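/- Let $n\ge 0$ and let $p$ be a polynomial on $\mathbf{C}^n$. For $A>0$ let $E_A$ be the normed space of entire functions $f$ on $\mathbf{C}^n$ with $\|f\|_A=\sup_{z}|f(z)|e^{-A|z|}<\infty$, where $|z|$ is the Euclidean norm, and let $\mathrm{Exp}(\mathbf{C}^n)=\bigcup_{A>0}E_A=\operatorname{ind\,lim}_{A>0}E_A$ be the algebra of entire functions of exponential type with the (locally convex) inductive limit topology. Put $V_p=\{z\in\mathbf{C}^n : p(z)=0\}$, and let $\mathrm{Exp}(V_p)$ be the space of restrictions to $V_p$ of the functions in $\mathrm{Exp}(\mathbf{C}^n)$, with the quotient topology of the restriction map $r:\mathrm{Exp}(\mathbf{C}^n)\to\mathrm{Exp}(V_p)$. Let $\mathrm{Exp}'(\mathbf{C}^n)$ and $\mathrm{Exp}'(V_p)$ be the dual spaces with their strong dual topologies, and let ${}^t r:\mathrm{Exp}'(V_p)\to\mathrm{Exp}'(\mathbf{C}^n)$, $S\mapsto S\circ r$, be the transpose of $r$. Set $$\mathcal{K}_p^E=\{f\in\mathrm{Exp}(\mathbf{C}^n) : f|_{V_p}=0\},\qquad \mathrm{Exp}'(\mathbf{C}^n;\mathcal{K}_p^E)=\{T\in\mathrm{Exp}'(\mathbf{C}^n)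 : T|_{\mathcal{K}_p^E}=0\},$$ $$\mathrm{Exp}'(\mathbf{C}^n)_p=\{T\in\mathrm{Exp}'(\mathbf{C}^n) : pT=0\},\qquad\text{where } (pT)(f)=T(pf),$$ the last two with the topology induced by $\mathrm{Exp}'(\mathbf{C}^n)$. Then: (1) The transpose ${}^t r$ is a topological linear isomorphism from $\mathrm{Exp}'(V_p)$ onto $\mathrm{Exp}'(\mathbf{C}^n;\mathcal{K}_p^E)$, and $\mathrm{Exp}'(\mathbf{C}^n;\mathcal{K}_p^E)$ is a subspace of $\mathrm{Exp}'(\mathbf{C}^n)_p$. (2) If $\mathcal{K}_p^E$ is the principal ideal of $\mathrm{Exp}(\mathbf{C}^n)$ generated by $p$, then $\mathrm{Exp}'(\mathbf{C}^n;\mathcal{K}_p^E)=\mathrm{Exp}'(\mathbf{C}^n)_p$. -/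

import Mathlib

open Topology

/-! ### The Banach spaces `E_A` of entire functions with `sup |f(z)| exp(-A|z|) < ∞` -/

/-- `ℂⁿ` with its Euclidean (Hermitian) norm. -/
abbrev Cn (n : ℕ) : Type := EuclideanSpace ℂ (Fin n)

/-- The function `z ↦ |f(z)| exp(-A|z|)`. -/
noncomputable def expWeighted {n : ℕ} (A : ℝ) (f : Cn n → ℂ) (z : Cn n) : ℝ :=
  ‖f z‖ * Real.exp (-A * ‖z‖)

/-- The space of entire functions `f` on `ℂⁿ` with `sup_z |f(z)| exp(-A|z|) < ∞`. -/
def growthSubmodule (n : ℕ) (A : ℝ) : Submodule ℂ (Cn n → ℂ) where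
  carrier := {f | Differentiable ℂ f ∧ BddAbove (Set.range (expWeighted A f))}
  zero_mem' := by
    refine ⟨differentiable_const 0, 0, ?_⟩
    rintro _ ⟨z, rfl⟩
    simp [expWeighted]
  add_mem' := by
    rintro f g ⟨hf, M, hM⟩ ⟨hg, N, hN⟩
    refine ⟨hf.add hg, M + N, ?_⟩
    rintro _ ⟨z, rfl⟩
    have h1 := hM ⟨z, rfl⟩
    have h2 := hN ⟨z, rfl⟩
    have h3 : expWeighted A (f + g) z ≤ expWeighted A f z + expWeighted A g z := by
      simp only [expWeighted, Pi.add_apply, ← add_mul]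
      gcongr
      exact norm_add_le _ _
    linarith
  smul_mem' := by
    rintro c f ⟨hf, M, hM⟩
    refine ⟨hf.const_smul c, ‖c‖ * M, ?_⟩
    rintro _ ⟨z, rfl⟩
    have h1 := hM ⟨z, rfl⟩
    have h2 : expWeighted A (c • f) z = ‖c‖ * expWeighted A f z := by
      simp only [expWeighted, Pi.smul_apply, norm_smul, mul_assoc]
    rw [h2]
    gcongr

/-- The space `E_A`, as a type of its own (so that it carries only the topology of its norm). -/
def GrowthSpace (n : ℕ) (A : ℝ) : Type := ↥(growthSubmodule n A)

namespace GrowthSpace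

variable {n : ℕ} {A : ℝ}

instance : AddCommGroup (GrowthSpace n A) := inferInstanceAs (AddCommGroup ↥(growthSubmodule n A))

instance : Module ℂ (GrowthSpace n A) := inferInstanceAs (Module ℂ ↥(growthSubmodule n A))

/-- The underlying function of an element of `E_A`. -/
def toFun (f : GrowthSpace n A) : Cn n → ℂ := f.1

/-- `‖f‖_A = sup_z |f(z)| exp(-A|z|)`. -/
noncomputable instance : Norm (GrowthSpace n A) := ⟨fun f => ⨆ z, expWeighted A f.toFun z⟩

theorem norm_def (f : GrowthSpace n A) : ‖f‖ = ⨆ z, expWeighted A f.toFun z := rfl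

theorem le_norm (f : GrowthSpace n A) (z : Cn n) : expWeighted A f.toFun z ≤ ‖f‖ :=
  le_ciSup f.2.2 z

theorem core : NormedSpace.Core ℂ (GrowthSpace n A) where
  norm_nonneg f := Real.iSup_nonneg fun z => by unfold expWeighted; positivity
  norm_smul c f := by
    rw [norm_def, norm_def, Real.mul_iSup_of_nonneg (norm_nonneg c)]
    congr 1
    funext z
    change ‖c • f.toFun z‖ * _ = _
    rw [norm_smul, mul_assoc]
    rfl
  norm_triangle f g := by
    rw [norm_def (f + g)]
    refine ciSup_le fun z => ?_
    refine le_trans ?_ (add_le_add (f.le_norm z) (g.le_norm z))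
    change ‖f.toFun z + g.toFun z‖ * _ ≤ ‖f.toFun z‖ * _ + ‖g.toFun z‖ * _
    rw [← add_mul]
    gcongr
    exact norm_add_le _ _
  norm_eq_zero_iff f := by
    constructor
    · intro h
      refine Subtype.ext (funext fun z => ?_)
      have h1 := f.le_norm z
      rw [h] at h1
      have h2 : ‖f.toFun z‖ ≤ 0 := by
        by_contra hc
        exact absurd h1 (not_le.mpr (mul_pos (not_le.mp hc) (Real.exp_pos _)))
      exact norm_le_zero_iff.mp h2
    · rintro rfl
      have h : ∀ z, expWeighted A (0 : GrowthSpace n A).toFun z = 0 := fun z => by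
        change ‖(0 : ℂ)‖ * _ = 0
        simp
      simp [norm_def, h]

noncomputable instance : NormedAddCommGroup (GrowthSpace n A) := NormedAddCommGroup.ofCore core

noncomputable instance : NormedSpace ℂ (GrowthSpace n A) := NormedSpace.ofCore core

end GrowthSpace

/-! ### The algebra `Exp(ℂⁿ)` of entire functions of exponential type -/

theorem expWeighted_le_of_le {n : ℕ} {A B : ℝ} (h : A ≤ B) (f : Cn n → ℂ) (z : Cn n) :
    expWeighted B f z ≤ expWeighted A f z := by
  unfold expWeighted
  gcongr

theorem growthSubmodule_mono (n : ℕ) {A B : ℝ} (h : A ≤ B) :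
    growthSubmodule n A ≤ growthSubmodule n B := by
  rintro f ⟨hf, M, hM⟩
  refine ⟨hf, M, ?_⟩
  rintro _ ⟨z, rfl⟩
  exact (expWeighted_le_of_le h f z).trans (hM ⟨z, rfl⟩)

theorem expWeighted_mul {n : ℕ} (A B : ℝ) (f g : Cn n → ℂ) (z : Cn n) :
    expWeighted (A + B) (f * g) z = expWeighted A f z * expWeighted B g z := by
  simp only [expWeighted, Pi.mul_apply, norm_mul]
  rw [show -(A + B) * ‖z‖ = -A * ‖z‖ + -B * ‖z‖ by ring, Real.exp_add]
  ring

theorem expWeighted_nonneg {n : ℕ} (A : ℝ) (f : Cn n → ℂ) (z : Cn n) : 0 ≤ expWeighted A f z := by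
  unfold expWeighted
  positivity

theorem mul_mem_growthSubmodule {n : ℕ} {A B : ℝ} {f g : Cn n → ℂ}
    (hf : f ∈ growthSubmodule n A) (hg : g ∈ growthSubmodule n B) :
    f * g ∈ growthSubmodule n (A + B) := by
  obtain ⟨hf, M, hM⟩ := hf
  obtain ⟨hg, N, hN⟩ := hg
  refine ⟨hf.mul hg, M * N, ?_⟩
  rintro _ ⟨z, rfl⟩
  rw [expWeighted_mul]
  have h1 := hM ⟨z, rfl⟩
  have h2 := hN ⟨z, rfl⟩
  exact mul_le_mul h1 h2 (expWeighted_nonneg _ _ _) ((expWeighted_nonneg _ _ _).trans h1)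

theorem const_mem_growthSubmodule {n : ℕ} (c : ℂ) :
    (fun _ => c : Cn n → ℂ) ∈ growthSubmodule n 1 := by
  refine ⟨differentiable_const c, ‖c‖, ?_⟩
  rintro _ ⟨z, rfl⟩
  refine mul_le_of_le_one_right (norm_nonneg c) (Real.exp_le_one_iff.mpr ?_)
  have := norm_nonneg z
  linarith

/-- The algebra `⋃_{A > 0} E_A` of entire functions of exponential type on `ℂⁿ`. -/
def expSubalgebra (n : ℕ) : Subalgebra ℂ (Cn n → ℂ) where
  carrier := {f | ∃ A : ℝ, 0 < A ∧ f ∈ growthSubmodule n A}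
  add_mem' := by
    rintro f g ⟨A, hA, hf⟩ ⟨B, hB, hg⟩
    exact ⟨max A B, lt_max_of_lt_left hA, add_mem (growthSubmodule_mono n (le_max_left A B) hf)
      (growthSubmodule_mono n (le_max_right A B) hg)⟩
  mul_mem' := by
    rintro f g ⟨A, hA, hf⟩ ⟨B, hB, hg⟩
    exact ⟨A + B, add_pos hA hB, mul_mem_growthSubmodule hf hg⟩
  algebraMap_mem' c := ⟨1, one_pos, const_mem_growthSubmodule c⟩

/-- `Exp(ℂⁿ)`, as a type of its own (so that it does not inherit the topology of pointwise
convergence). -/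
def ExpSpace (n : ℕ) : Type := ↥(expSubalgebra n)

namespace ExpSpace

variable {n : ℕ}

noncomputable instance : CommRing (ExpSpace n) := inferInstanceAs (CommRing ↥(expSubalgebra n))

noncomputable instance : Algebra ℂ (ExpSpace n) := inferInstanceAs (Algebra ℂ ↥(expSubalgebra n))

/-- The underlying function of an element of `Exp(ℂⁿ)`. -/
instance : CoeFun (ExpSpace n) (fun _ => Cn n → ℂ) := ⟨fun f => f.1⟩

@[ext] theorem ext {f g : ExpSpace n} (h : ∀ z, f z = g z) : f = g := Subtype.ext (funext h)

/-- The inclusion `E_A → Exp(ℂⁿ)`, for `A > 0`. -/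
noncomputable def ofGrowth {A : ℝ} (hA : 0 < A) : GrowthSpace n A →ₗ[ℂ] ExpSpace n where
  toFun f := ⟨f.1, A, hA, f.2⟩
  map_add' _ _ := rfl
  map_smul' _ _ := rfl

/-- The class of locally convex vector space topologies on `Exp(ℂⁿ)` for which all the inclusions
`E_A → Exp(ℂⁿ)`, `A > 0`, are continuous. -/
def admissibleTopologies (n : ℕ) : Set (TopologicalSpace (ExpSpace n)) :=
  {t | @IsTopologicalAddGroup (ExpSpace n) t _ ∧
    @ContinuousSMul ℂ (ExpSpace n) _ _ t ∧
    @LocallyConvexSpace ℝ (ExpSpace n) _ _ _ _ t ∧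
    ∀ (A : ℝ) (hA : 0 < A), @Continuous (GrowthSpace n A) (ExpSpace n) _ t (ofGrowth hA)}

/-- The inductive limit topology on `Exp(ℂⁿ) = ind lim_{A > 0} E_A`: the finest locally convex
vector space topology for which all the inclusions of the `E_A` are continuous. -/
instance : TopologicalSpace (ExpSpace n) := sInf (admissibleTopologies n)

instance : IsTopologicalAddGroup (ExpSpace n) := topologicalAddGroup_sInf fun _ h => h.1

instance : ContinuousSMul ℂ (ExpSpace n) := continuousSMul_sInf fun _ h => h.2.1

instance : LocallyConvexSpace ℝ (ExpSpace n) := .sInf fun _ h => h.2.2.1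

theorem continuous_ofGrowth {A : ℝ} (hA : 0 < A) :
    Continuous (ofGrowth hA : GrowthSpace n A → ExpSpace n) :=
  continuous_sInf_rng.mpr fun _ h => h.2.2.2 A hA

/-- The universal property of the inductive limit. -/
theorem continuous_of_forall {F : Type*} [AddCommGroup F] [Module ℂ F] [t : TopologicalSpace F]
    [IsTopologicalAddGroup F] [ContinuousSMul ℂ F] [LocallyConvexSpace ℝ F]
    (L : ExpSpace n →ₗ[ℂ] F)
    (h : ∀ (A : ℝ) (hA : 0 < A), Continuous fun f : GrowthSpace n A => L (ofGrowth hA f)) :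
    Continuous L := by
  rw [continuous_iff_le_induced]
  refine sInf_le ⟨topologicalAddGroup_induced L, continuousSMul_induced L, ?_, fun A hA => ?_⟩
  · exact LocallyConvexSpace.induced (L.restrictScalars ℝ)
  · exact continuous_induced_rng.mpr (h A hA)

theorem continuous_mul_left (g : ExpSpace n) : Continuous (LinearMap.mulLeft ℂ g) := by
  refine continuous_of_forall _ fun A hA => ?_
  obtain ⟨B, hB, hg⟩ := g.2
  let g' : GrowthSpace n B := ⟨g.1, hg⟩
  let L : GrowthSpace n A →ₗ[ℂ] GrowthSpace n (B + A) :=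
    { toFun := fun f => ⟨g.1 * f.1, mul_mem_growthSubmodule hg f.2⟩
      map_add' := fun f₁ f₂ => Subtype.ext (mul_add g.1 f₁.1 f₂.1)
      map_smul' := fun c f => Subtype.ext (mul_smul_comm c g.1 f.1) }
  have hL : Continuous L := by
    refine (L.mkContinuous ‖g'‖ fun f => ?_).continuous
    rw [GrowthSpace.norm_def]
    refine ciSup_le fun z => ?_
    have h := expWeighted_mul B A g.1 f.1 z
    change expWeighted (B + A) (g.1 * f.1) z ≤ _
    rw [h]
    exact mul_le_mul (g'.le_norm z) (f.le_norm z) (expWeighted_nonneg _ _ _)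
      (GrowthSpace.core.norm_nonneg g')
  exact (continuous_ofGrowth (add_pos hB hA)).comp hL

/-- Multiplication by a fixed `g ∈ Exp(ℂⁿ)`, as a continuous linear operator on `Exp(ℂⁿ)`. -/
noncomputable def mulOp (g : ExpSpace n) : ExpSpace n →L[ℂ] ExpSpace n :=
  ⟨LinearMap.mulLeft ℂ g, continuous_mul_left g⟩

/-- The operator `τ_g : T ↦ gT` on the strong dual `Exp'(ℂⁿ)`, where `(gT)(f) = T(gf)`. -/
noncomputable def tau (g : ExpSpace n) :
    StrongDual ℂ (ExpSpace n) →L[ℂ] StrongDual ℂ (ExpSpace n) :=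
  (mulOp g).precomp ℂ

theorem tau_apply (g : ExpSpace n) (T : StrongDual ℂ (ExpSpace n)) (f : ExpSpace n) :
    tau g T f = T (g * f) := rfl

end ExpSpace

/-! ### Polynomials, the variety `V_p`, and `Exp(V_p)` -/

theorem eval_mem_expSubalgebra {n : ℕ} (p : MvPolynomial (Fin n) ℂ) :
    (fun z : Cn n => MvPolynomial.eval (fun i => z i) p) ∈ expSubalgebra n := by
  induction p using MvPolynomial.induction_on with
  | C c =>
    simp only [MvPolynomial.eval_C]
    exact (expSubalgebra n).algebraMap_mem c
  | add p q hp hq =>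
    simp only [map_add]
    exact add_mem hp hq
  | mul_X p i hp =>
    simp only [map_mul, MvPolynomial.eval_X]
    refine mul_mem hp ⟨1, one_pos, ?_, 1, ?_⟩
    · exact (EuclideanSpace.proj i : Cn n →L[ℂ] ℂ).differentiable
    · rintro _ ⟨z, rfl⟩
      have h1 : ‖z i‖ ≤ ‖z‖ := PiLp.norm_apply_le z i
      have h2 : ‖z i‖ ≤ Real.exp ‖z‖ := by linarith [Real.add_one_le_exp ‖z‖]
      calc ‖z i‖ * Real.exp (-1 * ‖z‖) ≤ Real.exp ‖z‖ * Real.exp (-1 * ‖z‖) := by gcongr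
        _ = 1 := by rw [← Real.exp_add]; simp

/-- A polynomial `p`, regarded as an element of `Exp(ℂⁿ)`. -/
noncomputable def polyExp {n : ℕ} (p : MvPolynomial (Fin n) ℂ) : ExpSpace n :=
  ⟨fun z => MvPolynomial.eval (fun i => z i) p, eval_mem_expSubalgebra p⟩

/-- The zero set `V_p = {z ∈ ℂⁿ | p(z) = 0}`. -/
def zeroVariety {n : ℕ} (p : MvPolynomial (Fin n) ℂ) : Set (Cn n) :=
  {z | MvPolynomial.eval (fun i => z i) p = 0}

/-- Restriction of functions in `Exp(ℂⁿ)` to `V_p`. -/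
noncomputable def restrictFun {n : ℕ} (p : MvPolynomial (Fin n) ℂ) :
    ExpSpace n →ₗ[ℂ] (zeroVariety p → ℂ) where
  toFun f := fun z => f z
  map_add' _ _ := rfl
  map_smul' _ _ := rfl

/-- `Exp(V_p)`: the space of all functions on `V_p` that are restrictions of functions in
`Exp(ℂⁿ)`, as a type of its own. -/
def ExpVariety {n : ℕ} (p : MvPolynomial (Fin n) ℂ) : Type := ↥(LinearMap.range (restrictFun p))

namespace ExpVariety

variable {n : ℕ} {p : MvPolynomial (Fin n) ℂ}

noncomputable instance : AddCommGroup (ExpVariety p) :=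
  inferInstanceAs (AddCommGroup ↥(LinearMap.range (restrictFun p)))

noncomputable instance : Module ℂ (ExpVariety p) :=
  inferInstanceAs (Module ℂ ↥(LinearMap.range (restrictFun p)))

/-- The restriction map `r : Exp(ℂⁿ) → Exp(V_p)`. -/
noncomputable def restrictₗ (p : MvPolynomial (Fin n) ℂ) : ExpSpace n →ₗ[ℂ] ExpVariety p :=
  (restrictFun p).rangeRestrict

theorem restrictₗ_surjective : Function.Surjective (restrictₗ p) :=
  (restrictFun p).surjective_rangeRestrict

/-- The quotient topology of the restriction map. -/
noncomputable instance : TopologicalSpace (ExpVariety p) :=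
  TopologicalSpace.coinduced (restrictₗ p) inferInstance

theorem isOpenQuotientMap_restrictₗ : IsOpenQuotientMap (restrictₗ p) := by
  refine ⟨restrictₗ_surjective, continuous_coinduced_rng, fun U hU => ?_⟩
  rw [isOpen_coinduced]
  have h : restrictₗ p ⁻¹' (restrictₗ p '' U) =
      ⋃ k ∈ LinearMap.ker (restrictₗ p), (fun x => k + x) ⁻¹' U := by
    ext x
    simp only [Set.mem_preimage, Set.mem_image, Set.mem_iUnion, LinearMap.mem_ker, exists_prop]
    constructor
    · rintro ⟨y, hy, hxy⟩
      exact ⟨y - x, by rw [map_sub, hxy, sub_self], by simpa using hy⟩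
    · rintro ⟨k, hk, hx⟩
      exact ⟨k + x, hx, by rw [map_add, hk, zero_add]⟩
  rw [h]
  exact isOpen_biUnion fun k _ => hU.preimage (continuous_const.add continuous_id)

instance : IsTopologicalAddGroup (ExpVariety p) where
  continuous_add := by
    have hq := isOpenQuotientMap_restrictₗ (p := p)
    rw [(hq.prodMap hq).isQuotientMap.continuous_iff]
    have h : (fun x : ExpVariety p × ExpVariety p => x.1 + x.2) ∘
        Prod.map (restrictₗ p) (restrictₗ p) = fun x => restrictₗ p (x.1 + x.2) := by
      funext x
      simp
    rw [h]
    exact hq.continuous.comp continuous_add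
  continuous_neg := by
    have hq := isOpenQuotientMap_restrictₗ (p := p)
    rw [hq.isQuotientMap.continuous_iff]
    have h : (fun x : ExpVariety p => -x) ∘ restrictₗ p = fun x => restrictₗ p (-x) := by
      funext x
      simp
    rw [h]
    exact hq.continuous.comp continuous_neg

instance : ContinuousSMul ℂ (ExpVariety p) where
  continuous_smul := by
    have hq := isOpenQuotientMap_restrictₗ (p := p)
    rw [(IsOpenQuotientMap.id.prodMap hq).isQuotientMap.continuous_iff]
    have h : (fun x : ℂ × ExpVariety p => x.1 • x.2) ∘
        Prod.map id (restrictₗ p) = fun x => restrictₗ p (x.1 • x.2) := by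
      funext x
      simp
    rw [h]
    exact hq.continuous.comp continuous_smul

/-- The restriction map `r : Exp(ℂⁿ) → Exp(V_p)` as a continuous linear map. -/
noncomputable def restrict (p : MvPolynomial (Fin n) ℂ) : ExpSpace n →L[ℂ] ExpVariety p :=
  ⟨restrictₗ p, continuous_coinduced_rng⟩

/-- The transpose `ᵗr : Exp'(V_p) → Exp'(ℂⁿ)`, `S ↦ S ∘ r`, between the strong duals. -/
noncomputable def transposeRestrict (p : MvPolynomial (Fin n) ℂ) :
    StrongDual ℂ (ExpVariety p) →L[ℂ] StrongDual ℂ (ExpSpace n) :=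
  (restrict p).precomp ℂ

end ExpVariety

/-- `K_p^E = {f ∈ Exp(ℂⁿ) | f = 0 on V_p}`, an ideal of `Exp(ℂⁿ)`. -/
noncomputable def vanishingExp {n : ℕ} (p : MvPolynomial (Fin n) ℂ) : Ideal (ExpSpace n) where
  carrier := {f | ∀ z ∈ zeroVariety p, f z = 0}
  zero_mem' _ _ := rfl
  add_mem' := by
    intro f g hf hg z hz
    change f z + g z = 0
    rw [hf z hz, hg z hz, add_zero]
  smul_mem' := by
    intro g f hf z hz
    change g z * f z = 0
    rw [hf z hz, mul_zero]

/-- `Exp'(ℂⁿ; K_p^E)`: the functionals in `Exp'(ℂⁿ)` that vanish on `K_p^E`. -/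
noncomputable def annihilatorVanishing {n : ℕ} (p : MvPolynomial (Fin n) ℂ) :
    Submodule ℂ (StrongDual ℂ (ExpSpace n)) where
  carrier := {T | ∀ f ∈ vanishingExp p, T f = 0}
  zero_mem' _ _ := rfl
  add_mem' := by
    intro S T hS hT f hf
    change S f + T f = 0
    rw [hS f hf, hT f hf, add_zero]
  smul_mem' := by
    intro c T hT f hf
    change c • T f = 0
    rw [hT f hf, smul_zero]

/-- `Exp'(ℂⁿ)_p = ker τ_p`: the functionals `T ∈ Exp'(ℂⁿ)` with `pT = 0`. -/
noncomputable def kerTau {n : ℕ} (p : MvPolynomial (Fin n) ℂ) :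
    Submodule ℂ (StrongDual ℂ (ExpSpace n)) :=
  LinearMap.ker (ExpSpace.tau (polyExp p)).toLinearMap

/-! ### Boundedness in `Exp(V_p)`, tested on the balls of the `E_A`. -/

namespace ExpVariety

variable {n : ℕ} {p : MvPolynomial (Fin n) ℂ}

/-! That `ᵗr` is a continuous bijection onto the annihilator is formal: `r` is a quotient map with
kernel `K_p^E`. The substance is that the inverse is continuous for the strong topologies: smallness
on each bounded `B ⊆ Exp(V_p)` must follow from smallness on some bounded subset of `Exp(ℂⁿ)`,
although `B` is not known to lift to one. By `exists_growth_bound` the unit ball of a single `E_A`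
suffices. Otherwise there are `S_m`, bounded by `1` on the unit ball of `E_{m+1}`, with values
larger than `m` on `B`. On a fixed `E_A` all but finitely many `S_m` are bounded by `1` on the unit
ball, so `b ↦ (S_m b)_m` is a continuous linear map into `ℓ^∞`. It maps `B` to a bounded set, a
contradiction. The comparison with `Exp'(ℂⁿ)_p` only uses that multiples of `p` vanish on `V_p`. -/

/-- A sequence of functionals on `Exp(V_p)` that is eventually bounded on the unit ball of each
`E_m` is uniformly bounded on each bounded subset of `Exp(V_p)`. -/
theorem exists_bound_of_bound_on_balls (S : ℕ → StrongDual ℂ (ExpVariety p))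
    (hS : ∀ (m : ℕ) (f : GrowthSpace n (m + 1)), ‖f‖ ≤ 1 →
      ‖S m (restrict p (ExpSpace.ofGrowth (by positivity) f))‖ ≤ 1)
    {B : Set (ExpVariety p)} (hB : Bornology.IsVonNBounded ℂ B) :
    ∃ C : ℝ, ∀ b ∈ B, ∀ m, ‖S m b‖ ≤ C := by
  have hbound : ∀ (A : ℝ) (hA : 0 < A), ∃ C : ℝ, ∀ (f : GrowthSpace n A) (m : ℕ),
      ‖S m (restrict p (ExpSpace.ofGrowth hA f))‖ ≤ C * ‖f‖ := by
    intro A hA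
    obtain ⟨k, hk⟩ := exists_nat_ge A
    let φ : ℕ → (GrowthSpace n A →L[ℂ] ℂ) := fun m =>
      (S m ∘L restrict p) ∘L ⟨ExpSpace.ofGrowth hA, ExpSpace.continuous_ofGrowth hA⟩
    have hφ : ∀ m f, φ m f = S m (restrict p (ExpSpace.ofGrowth hA f)) := fun _ _ => rfl
    have hnn : ∀ m ∈ Finset.range k, 0 ≤ ‖φ m‖ := fun m _ => norm_nonneg _
    -- The summand `1` serves all `m ≥ k`; the sum absorbs the finitely many `m < k`, where only
    -- continuity of `S m` is available.
    refine ⟨1 + ∑ m ∈ Finset.range k, ‖φ m‖, fun f m => ?_⟩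
    rw [← hφ]
    suffices h : ‖φ m‖ ≤ 1 + ∑ m ∈ Finset.range k, ‖φ m‖ from (φ m).le_of_opNorm_le h f
    by_cases hm : m < k
    · have := Finset.single_le_sum hnn (Finset.mem_range.mpr hm)
      linarith
    · have hAm : A ≤ (m : ℝ) + 1 := by
        have : (k : ℝ) ≤ m := by exact_mod_cast not_lt.mp hm
        linarith
      have h1 : ‖φ m‖ ≤ 1 := by
        refine ContinuousLinearMap.opNorm_le_of_unit_norm zero_le_one fun f hf => ?_
        -- The inclusion of `E_A` into `E_{m+1}` does not increase norms, so `f` stays in the unit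
        -- ball.
        let g : GrowthSpace n (m + 1) := ⟨f.1, growthSubmodule_mono n hAm f.2⟩
        refine hS m g ((ciSup_le fun z => ?_).trans hf.le)
        exact (expWeighted_le_of_le hAm f.1 z).trans (f.le_norm z)
      have := Finset.sum_nonneg hnn
      linarith
  have hpt : ∀ b : ExpVariety p, ∃ C : ℝ, ∀ m, ‖S m b‖ ≤ C := by
    intro b
    obtain ⟨f, rfl⟩ := restrictₗ_surjective b
    obtain ⟨A, hA, hf⟩ := f.2
    obtain ⟨C, hC⟩ := hbound A hA
    exact ⟨_, hC ⟨f.1, hf⟩⟩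
  choose c hc using hpt
  -- All the `S m` are packed into one map to `ℓ^∞`, so that a uniform bound on `B` becomes
  -- boundedness of the image of `B`.
  let L : ExpVariety p →ₗ[ℂ] BoundedContinuousFunction ℕ ℂ :=
    { toFun := fun b =>
        BoundedContinuousFunction.ofNormedAddCommGroupDiscrete (fun m => S m b) (c b) (hc b)
      map_add' := fun a b => by ext m; exact map_add (S m) a b
      map_smul' := fun r b => by ext m; exact map_smul (S m) r b }
  have hL : Continuous L := by
    refine isOpenQuotientMap_restrictₗ.isQuotientMap.continuous_iff.mpr ?_
    refine ExpSpace.continuous_of_forall (L ∘ₗ restrictₗ p) fun A hA => ?_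
    obtain ⟨C, hC⟩ := hbound A hA
    refine (((L ∘ₗ restrictₗ p) ∘ₗ ExpSpace.ofGrowth hA).mkContinuous (max C 0)
      fun f => ?_).continuous
    refine (BoundedContinuousFunction.norm_le (by positivity)).mpr fun m => ?_
    exact (hC f m).trans (by gcongr; exact le_max_left _ _)
  have hLB := NormedSpace.isVonNBounded_iff ℂ |>.mp (hB.image (⟨L, hL⟩ : _ →L[ℂ] _))
  obtain ⟨C, hC⟩ := hLB.exists_norm_le
  exact ⟨C, fun b hb m => (BoundedContinuousFunction.norm_coe_le_norm (L b) m).trans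
    (hC _ ⟨b, hb, rfl⟩)⟩

/-- Functionals that are bounded by `1` on the image of the unit ball of a suitable `E_A` are
uniformly bounded on a given bounded subset of `Exp(V_p)`. -/
theorem exists_growth_bound {B : Set (ExpVariety p)} (hB : Bornology.IsVonNBounded ℂ B) :
    ∃ (A : ℝ) (hA : 0 < A) (C : ℝ), ∀ S : StrongDual ℂ (ExpVariety p),
      (∀ f : GrowthSpace n A, ‖f‖ ≤ 1 → ‖S (restrict p (ExpSpace.ofGrowth hA f))‖ ≤ 1) →
      ∀ b ∈ B, ‖S b‖ ≤ C := by
  by_contra! h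
  choose S hS b hb hlt using fun m : ℕ => h (m + 1) (by positivity) m
  obtain ⟨C, hC⟩ := exists_bound_of_bound_on_balls S hS hB
  obtain ⟨m, hm⟩ := exists_nat_ge C
  exact absurd (hC _ (hb m) m) (not_le.mpr (hm.trans_lt (hlt m)))

/-! ### The algebraic isomorphism. -/

theorem transposeRestrict_apply (S : StrongDual ℂ (ExpVariety p)) (f : ExpSpace n) :
    transposeRestrict p S f = S (restrict p f) := rfl

theorem restrictₗ_eq_zero_iff {f : ExpSpace n} : restrictₗ p f = 0 ↔ f ∈ vanishingExp p := by
  constructor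
  · exact fun h z hz => congrFun (congrArg Subtype.val h) ⟨z, hz⟩
  · exact fun h => Subtype.ext (funext fun z => h z z.2)

theorem transposeRestrict_mem (S : StrongDual ℂ (ExpVariety p)) :
    transposeRestrict p S ∈ annihilatorVanishing p := fun f hf => by
  have h : restrict p f = 0 := restrictₗ_eq_zero_iff.mpr hf
  rw [transposeRestrict_apply, h, map_zero]

/-- The transpose of the restriction map, with codomain `Exp'(ℂⁿ; K_p^E)`. -/
noncomputable def transposeToAnnihilator (p : MvPolynomial (Fin n) ℂ) :
    StrongDual ℂ (ExpVariety p) →L[ℂ] annihilatorVanishing p :=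
  (transposeRestrict p).codRestrict _ transposeRestrict_mem

theorem transposeToAnnihilator_injective : Function.Injective (transposeToAnnihilator p) := by
  intro S T h
  ext b
  obtain ⟨f, rfl⟩ := restrictₗ_surjective b
  exact DFunLike.congr_fun (congrArg Subtype.val h) f

theorem transposeToAnnihilator_surjective : Function.Surjective (transposeToAnnihilator p) := by
  rintro ⟨T, hT⟩
  let e := (restrictₗ p).quotKerEquivOfSurjective restrictₗ_surjective
  let S : ExpVariety p →ₗ[ℂ] ℂ :=
    (LinearMap.ker (restrictₗ p)).liftQ T.toLinearMap
      (fun f hf => hT f (restrictₗ_eq_zero_iff.mp hf)) ∘ₗ e.symm.toLinearMap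
  have hS : ∀ f, S (restrictₗ p f) = T f := by
    intro f
    have h : e.symm (restrictₗ p f) = Submodule.Quotient.mk f := by
      rw [LinearEquiv.symm_apply_eq]
      rfl
    simp only [S, LinearMap.comp_apply, LinearEquiv.coe_coe, h]
    rfl
  -- For the quotient topology, continuity of `S` is continuity of `S ∘ r = T`.
  have hcont : Continuous S := by
    refine isOpenQuotientMap_restrictₗ.isQuotientMap.continuous_iff.mpr ?_
    rw [show S ∘ restrictₗ p = T from funext hS]
    exact T.continuous
  exact ⟨⟨S, hcont⟩, Subtype.ext (ContinuousLinearMap.ext hS)⟩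

/-- The algebraic isomorphism of `Exp'(V_p)` with `Exp'(ℂⁿ; K_p^E)`. -/
noncomputable def transposeLinearEquiv (p : MvPolynomial (Fin n) ℂ) :
    StrongDual ℂ (ExpVariety p) ≃ₗ[ℂ] annihilatorVanishing p :=
  LinearEquiv.ofBijective (transposeToAnnihilator p).toLinearMap
    ⟨transposeToAnnihilator_injective, transposeToAnnihilator_surjective⟩

/-! ### Continuity of the inverse. -/

/-- A basic neighbourhood of zero in `Exp'(V_p)` is given by a bounded `B` and an `ε`. The image in
`Exp(ℂⁿ)` of the unit ball of the `E_A` from `exists_growth_bound` is bounded, so it defines a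
neighbourhood in `Exp'(ℂⁿ)` that the inverse sends into the given one. -/
theorem continuous_transposeLinearEquiv_symm : Continuous (transposeLinearEquiv p).symm := by
  refine continuous_of_continuousAt_zero (transposeLinearEquiv p).symm ?_
  rw [ContinuousAt, map_zero]
  refine (ContinuousLinearMap.hasBasis_nhds_zero_of_basis
    (Metric.nhds_basis_closedBall (x := (0 : ℂ)))).tendsto_right_iff.mpr ?_
  rintro ⟨B, ε⟩ ⟨hB, hε : 0 < ε⟩
  obtain ⟨A, hA, C, hC⟩ := exists_growth_bound hB
  -- Chosen so that `δ * C ≤ ε`; `|C| + 1` is positive whatever the sign of `C`.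
  set δ : ℝ := ε / (|C| + 1) with hδ
  have hδ0 : 0 < δ := by positivity
  have hK : Bornology.IsVonNBounded ℂ
      (ExpSpace.ofGrowth hA '' Metric.closedBall (0 : GrowthSpace n A) 1) :=
    (NormedSpace.isVonNBounded_closedBall ℂ _ 1).image
      (⟨ExpSpace.ofGrowth hA, ExpSpace.continuous_ofGrowth hA⟩ : _ →L[ℂ] ExpSpace n)
  have hU := (ContinuousLinearMap.hasBasis_nhds_zero_of_basis (σ := RingHom.id ℂ)
    (E := ExpSpace n) (Metric.nhds_basis_closedBall (x := (0 : ℂ)))).mem_of_mem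
    (i := (_, δ)) ⟨hK, hδ0⟩
  filter_upwards [continuous_subtype_val.continuousAt.preimage_mem_nhds hU] with T hT b hb
  obtain ⟨S, rfl⟩ := (transposeLinearEquiv p).surjective T
  rw [LinearEquiv.symm_apply_apply, mem_closedBall_zero_iff]
  have hSK : ∀ f : GrowthSpace n A, ‖f‖ ≤ 1 →
      ‖S (restrict p (ExpSpace.ofGrowth hA f))‖ ≤ δ := fun f hf =>
    mem_closedBall_zero_iff.mp (hT _ ⟨f, mem_closedBall_zero_iff.mpr hf, rfl⟩)
  have hnorm : ‖((δ⁻¹ : ℝ) : ℂ)‖ = δ⁻¹ := by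
    rw [Complex.norm_real, Real.norm_of_nonneg (by positivity)]
  -- Rescaling by `δ⁻¹` turns the bound `δ` on the unit ball of `E_A` into the bound `1` required by
  -- `hC`.
  have h := hC (((δ⁻¹ : ℝ) : ℂ) • S) (fun f hf => by
    rw [smul_apply, norm_smul, hnorm, inv_mul_le_one₀ hδ0]
    exact hSK f hf) b hb
  rw [smul_apply, norm_smul, hnorm, inv_mul_le_iff₀ hδ0] at h
  refine h.trans ?_
  rw [hδ, div_mul_eq_mul_div, div_le_iff₀ (by positivity)]
  have := le_abs_self C
  gcongr
  linarith

end ExpVariety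

/-! ### Comparison with the kernel of multiplication by `p`. -/

theorem mul_polyExp_mem_vanishingExp {n : ℕ} (p : MvPolynomial (Fin n) ℂ) (f : ExpSpace n) :
    polyExp p * f ∈ vanishingExp p := fun z hz => by
  have h : MvPolynomial.eval (fun i => z i) p = 0 := hz
  change MvPolynomial.eval (fun i => z i) p * f z = 0
  rw [h, zero_mul]

theorem mem_kerTau_iff {n : ℕ} {p : MvPolynomial (Fin n) ℂ} {T : StrongDual ℂ (ExpSpace n)} :
    T ∈ kerTau p ↔ ∀ f, T (polyExp p * f) = 0 :=
  ContinuousLinearMap.ext_iff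

theorem proposition2p3 (n : ℕ) (p : MvPolynomial (Fin n) ℂ) :
    ((∃ e : StrongDual ℂ (ExpVariety p) ≃L[ℂ] annihilatorVanishing p,
        ∀ S : StrongDual ℂ (ExpVariety p),
          (e S : StrongDual ℂ (ExpSpace n)) = ExpVariety.transposeRestrict p S) ∧
      annihilatorVanishing p ≤ kerTau p) ∧
    (vanishingExp p = Ideal.span {polyExp p} → annihilatorVanishing p = kerTau p) := by
  have hle : annihilatorVanishing p ≤ kerTau p := fun T hT =>
    mem_kerTau_iff.mpr fun f => hT _ (mul_polyExp_mem_vanishingExp p f)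
  refine ⟨⟨⟨⟨ExpVariety.transposeLinearEquiv p,
    (ExpVariety.transposeToAnnihilator p).continuous,
    ExpVariety.continuous_transposeLinearEquiv_symm⟩, fun _ => rfl⟩, hle⟩, fun h => ?_⟩
  refine le_antisymm hle fun T hT f hf => ?_
  -- In the principal case every `f` in `K_p^E` is a multiple `p g`, and `T (p g) = (pT) g = 0`.
  rw [h, Ideal.mem_span_singleton] at hf
  obtain ⟨g, rfl⟩ := hf
  exact mem_kerTau_iff.mp hT g
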